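/- Let $N,I,N_{\rm pu}$ be natural numbers, $\sigma>0$, $P_{\rm sb}>0$. For every subcarrier $i=1,\dots,I$ let $\tilde{\mathbf c}_r[i]$ ($r=1,\dots,5$) be square-integrable random vectors in $\mathbb C^N$, let $\mathbf h[r,i]\in\mathbb C^N$ ($r=1,\dots,N_{\rm pu}$) be the channels to the primary users, and let $\epsilon[i]>0$, $\delta[i]>0$. Fix $\mathbf d_1,\mathbf d_2,\mathbf d_3\in\mathbb R^5$ and $\mathbf J_P\in\mathbb R^{5\times5}$, let $\mathbf e_j$ be the $j$-th unit vector of $\mathbb R^5$, and put $$\overline{\mathbf C}[i]=\sum_{j=1}^3\mathbb E\Big[\tfrac{2}{\sigma^2}\,\overline{\mathbf c}_{\mathbf d_j}[i]^*\,\overline{\mathbf c}_{\mathbf d_j}[i]^{\mathsf T}\Big],\quad \overline{\mathbf c}_{\mathbf d_j}[i]=\sum_{r=1}^5[\mathbf d_j]_r\tilde{\mathbf c}_r[i],\quad \mathbf A[i]=\tfrac12\big(\overline{\mathbf C}[i]+\overline{\mathbf C}[i]^{\mathsf H}\big),\quad \mathbf R[i]=\frac{P_{\rm sb}}{N_{\rm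 pu}}\sum_{r}\mathbf h[r,i]^*\mathbf h[r,i]^{\mathsf T}.$$ The inner problem is to minimize $$\sum_{j=1}^3\big(-\mathbf d_j^{\mathsf T}\mathbf J_P\mathbf d_j+2\mathbf d_j^{\mathsf T}\mathbf e_j\big)-\sum_{i=1}^I\Re\{\mathbf f[i]^{\mathsf H}\overline{\mathbf C}[i]\mathbf f[i]\}$$ over $\mathbf f[1],\dots,\mathbf f[I]\in\mathbb C^N$ subject to $\mathbf f[i]^{\mathsf H}\mathbf R[i]\mathbf f[i]\le\epsilon[i]$ and $\|\mathbf f[i]\|^2\le\delta[i]$ for all $i$. (0) A family $(\mathbf f[i])_i$ solves the inner problem if and only if, for each $i$, $\mathbf f[i]$ solves the subcarrier problem $\max \mathbf f^{\mathsf H}\mathbf A\mathbf f$ subject to $\mathbf f^{\mathsf H}\mathbf R\mathbf f\le\epsilon$, $\|\mathbf f\|^2\le\delta$ (with $\mathbf A=\mathbf A[i]$, and so on). For each subcarrier (index $i$ dropped; a principal unit eigenvector is a unit eigenvector for the largest eigenvalue $\lambda_{\max}$): (1) If $\lambda_{\max}(\mathbf A)\le0$, then $\mathbf f=\mathbf 0$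 is optimal. (2) If $\lambda_{\max}(\mathbf A)>0$ and $\mathbf u$ is a principal unit eigenvector of $\mathbf A$ with $\mathbf u^{\mathsf H}\mathbf R\mathbf u\le\epsilon/\delta$, then $\mathbf f=\sqrt\delta\,\mathbf u$ is optimal. (3) If $\mu>0$, $\mathbf v$ is a principal unit eigenvector of $\mathbf A-\mu\mathbf R$ with $\mathbf v^{\mathsf H}\mathbf R\mathbf v=\epsilon/\delta$, and $\mathbf R$ is singular (as it is when $N_{\rm pu}<N$) or $\lambda_{\max}(\mathbf A-\mu\mathbf R)\ge0$, then $\mathbf f=\sqrt\delta\,\mathbf v$ is optimal. (4) Let a routine be given that computes some principal unit eigenvector of every Hermitian matrix; write $\mathbf u$ and $\mathbf v(\mu)$ for its values at $\mathbf A$ and $\mathbf A-\mu\mathbf R$, and $g(\mu)=\mathbf v(\mu)^{\mathsf H}\mathbf R\mathbf v(\mu)$. Suppose that $\mathbf R$ is singular, that the principal eigenvalue of $\mathbf A-\mu\mathbf R$ is simple for every $\mu\ge0$, that $\lambda_{\max}(\mathbf A)>0$, and that $\mathbf u^{\mathsf H}\mathbf R\mathbf u>\epsilon/\delta$. Then doubling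 $\mu_u$, starting from $1$, while $g(\mu_u)>\epsilon/\delta$ stops after finitely many steps. The midpoints $\mu=(\mu_\ell+\mu_u)/2$ of the bisection that starts from $[0,\mu_u]$, and that replaces $\mu_\ell$ by $\mu$ if $g(\mu)>\epsilon/\delta$ and $\mu_u$ by $\mu$ otherwise, converge to some $\mu>0$ with $g(\mu)=\epsilon/\delta$; and $\mathbf f=\sqrt\delta\,\mathbf v(\mu)$ is optimal. (5) Consider the algorithm that returns $\mathbf 0$ if $\lambda_{\max}(\mathbf A)\le0$; else $\sqrt\delta\,\mathbf u$ if $\mathbf u^{\mathsf H}\mathbf R\mathbf u\le\epsilon/\delta$; else $\sqrt\delta\,\mathbf v(\mu)$ for the first bisection midpoint $\mu$ in (4) with $|g(\mu)-\epsilon/\delta|<\xi$. Suppose that on every subcarrier that reaches the last branch, $\mathbf R$ is singular and the principal eigenvalue of $\mathbf A-\mu\mathbf R$ is simple for every $\mu\ge0$. Then, for every tolerance $\xi>0$, the algorithm terminates on every subcarrier, and each output satisfies $\hat{\mathbf f}^{\mathsf H}\mathbf R\hat{\mathbf f}\le\epsilon+\delta\xi$ and $\|\hat{\mathbf f}\|^2\le\delta$.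 For every $\eta>0$ there is $\xi_0>0$ such that for all $0<\xi\le\xi_0$ the inner objective at the outputs is at most $\eta$ above its value at any feasible family. -/

import Mathlib

open Matrix MeasureTheory Filter Topology

noncomputable section

/-- Vectors of `ℂ^N` with the Euclidean norm. -/
abbrev CVec (N : ℕ) : Type := EuclideanSpace ℂ (Fin N)

/-- Square complex matrices of size `N`. -/
abbrev CMat (N : ℕ) : Type := Matrix (Fin N) (Fin N) ℂ

/-- `Re (f^H M f)`, which is `f^H M f` itself if `M` is Hermitian. -/
def quadRe {N : ℕ} (M : CMat N) (f : CVec N) : ℝ :=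
  (star f.ofLp ⬝ᵥ (M *ᵥ f.ofLp)).re

/-- The largest (real) eigenvalue of a Hermitian matrix. -/
def lambdaMax {N : ℕ} (M : CMat N) : ℝ :=
  sSup {t : ℝ | Module.End.HasEigenvalue (Matrix.toLin' M) (t : ℂ)}

/-- `v` is a unit eigenvector of `M` for the largest eigenvalue. -/
def IsPrincipalUnitEigenvector {N : ℕ} (M : CMat N) (v : CVec N) : Prop :=
  ‖v‖ = 1 ∧ M *ᵥ v.ofLp = (lambdaMax M : ℂ) • v.ofLp

/-- The largest eigenvalue of the Hermitian matrix `M` is simple. -/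
def HasSimplePrincipalEigenvalue {N : ℕ} (M : CMat N) : Prop :=
  Module.finrank ℂ (Module.End.eigenspace (Matrix.toLin' M) (lambdaMax M : ℂ)) = 1

/-! ### The data of the inner problem -/

/-- `c̄_d = ∑_r d_r c̃_r`, for one subcarrier. -/
def cBar {N : ℕ} {Γ : Type*} (c : Fin 5 → Γ → CVec N) (d : Fin 5 → ℝ) (γ : Γ) : CVec N :=
  ∑ r, ((d r : ℝ) : ℂ) • c r γ

/-- `C̄ = ∑_j E[(2/σ²) c̄_{d_j}^* c̄_{d_j}^T]`, for one subcarrier. -/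
def CBar {N : ℕ} {Γ : Type*} [MeasurableSpace Γ] (P : Measure Γ) (σ : ℝ)
    (c : Fin 5 → Γ → CVec N) (d : Fin 3 → Fin 5 → ℝ) : CMat N :=
  ∑ j, Matrix.of fun m n =>
    ∫ γ, ((2 / σ ^ 2 : ℝ) : ℂ) *
      Matrix.vecMulVec (star (cBar c (d j) γ).ofLp) (cBar c (d j) γ).ofLp m n ∂P

/-- `A = (C + C^H)/2`. -/
def hermPart {N : ℕ} (C : CMat N) : CMat N := (1 / 2 : ℂ) • (C + Cᴴ)

/-- `R = (P_sb / N_pu) ∑_r h_r^* h_r^T`, for one subcarrier. -/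
def RPu {N Npu : ℕ} (Psb : ℝ) (h : Fin Npu → CVec N) : CMat N :=
  ((Psb / Npu : ℝ) : ℂ) • ∑ r, Matrix.vecMulVec (star (h r).ofLp) (h r).ofLp

/-- The feasible set for one subcarrier. -/
def feasible {N : ℕ} (R : CMat N) (ε δ : ℝ) : Set (CVec N) :=
  {f | quadRe R f ≤ ε ∧ ‖f‖ ^ 2 ≤ δ}

/-- `f` solves `max f^H A f` subject to `f^H R f ≤ ε` and `‖f‖² ≤ δ`. -/
def IsSubcarrierSolution {N : ℕ} (A R : CMat N) (ε δ : ℝ) (f : CVec N) : Prop :=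
  f ∈ feasible R ε δ ∧ IsMaxOn (quadRe A) (feasible R ε δ) f

/-- The feasible set of the inner problem over all subcarriers. -/
def innerFeasible {N I : ℕ} (R : Fin I → CMat N) (ε δ : Fin I → ℝ) : Set (Fin I → CVec N) :=
  {f | ∀ i, f i ∈ feasible (R i) (ε i) (δ i)}

/-- The objective of the inner problem,
`∑_j (-d_j^T J_P d_j + 2 d_j^T e_j) - ∑_i Re (f[i]^H C̄[i] f[i])`. -/
def innerObjective {N I : ℕ} (JP : Matrix (Fin 5) (Fin 5) ℝ) (d : Fin 3 → Fin 5 → ℝ)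
    (C : Fin I → CMat N) (f : Fin I → CVec N) : ℝ :=
  ∑ j : Fin 3, (-(d j ⬝ᵥ (JP *ᵥ d j))
      + 2 * (d j ⬝ᵥ Pi.single (Fin.castLE (by norm_num : 3 ≤ 5) j) (1 : ℝ)))
    - ∑ i, quadRe (C i) (f i)

/-- `f` solves the inner problem (a minimization). -/
def IsInnerSolution {N I : ℕ} (JP : Matrix (Fin 5) (Fin 5) ℝ) (d : Fin 3 → Fin 5 → ℝ)
    (C R : Fin I → CMat N) (ε δ : Fin I → ℝ) (f : Fin I → CVec N) : Prop :=
  f ∈ innerFeasible R ε δ ∧ IsMinOn (innerObjective JP d C) (innerFeasible R ε δ) f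

/-! ### The algorithm -/

/-- A routine that computes some principal unit eigenvector of every Hermitian matrix. -/
def IsEigRoutine {N : ℕ} (eig : CMat N → CVec N) : Prop :=
  ∀ M : CMat N, M.IsHermitian → IsPrincipalUnitEigenvector M (eig M)

/-- `g(μ) = v(μ)^H R v(μ)`, with `v(μ)` the computed principal unit eigenvector of `A - μ R`. -/
def gFun {N : ℕ} (eig : CMat N → CVec N) (A R : CMat N) (μ : ℝ) : ℝ :=
  quadRe R (eig (A - (μ : ℂ) • R))

/-- The loop "`μᵤ ← 1`; while `g(μᵤ) > t` do `μᵤ ← 2 μᵤ`" ends with the value `μᵤ`. -/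
def DoublingReturns (g : ℝ → ℝ) (t μᵤ : ℝ) : Prop :=
  ∃ k : ℕ, μᵤ = 2 ^ k ∧ g (2 ^ k) ≤ t ∧ ∀ m < k, t < g (2 ^ m)

/-- The midpoint of a bracket. -/
def bracketMid (s : ℝ × ℝ) : ℝ := (s.1 + s.2) / 2

/-- One bisection step on a bracket `(μₗ, μᵤ)`. -/
def bisectStep (g : ℝ → ℝ) (t : ℝ) (s : ℝ × ℝ) : ℝ × ℝ :=
  if t < g (bracketMid s) then (bracketMid s, s.2) else (s.1, bracketMid s)

/-- The `k`-th midpoint `μ` evaluated by the bisection that starts from `(0, μᵤ)`. -/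
def bisectMid (g : ℝ → ℝ) (t μᵤ : ℝ) (k : ℕ) : ℝ :=
  bracketMid ((bisectStep g t)^[k] (0, μᵤ))

/-- The bisection that starts from `(0, μᵤ)` and stops as soon as `|g(μ) - t| < ξ` ends with
the value `μ`. -/
def BisectionReturns (g : ℝ → ℝ) (t ξ μᵤ μ : ℝ) : Prop :=
  ∃ k : ℕ, μ = bisectMid g t μᵤ k ∧ |g (bisectMid g t μᵤ k) - t| < ξ ∧
    ∀ m < k, ξ ≤ |g (bisectMid g t μᵤ m) - t|

/-- The algorithm, run with the tolerance `ξ`, terminates and returns `f`. -/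
inductive AlgorithmReturns {N : ℕ} (eig : CMat N → CVec N) (A R : CMat N) (ε δ ξ : ℝ) :
    CVec N → Prop
  | zero : lambdaMax A ≤ 0 → AlgorithmReturns eig A R ε δ ξ 0
  | principal : 0 < lambdaMax A → quadRe R (eig A) ≤ ε / δ →
      AlgorithmReturns eig A R ε δ ξ ((Real.sqrt δ : ℂ) • eig A)
  | bisection (μᵤ μ : ℝ) : 0 < lambdaMax A → ε / δ < quadRe R (eig A) →
      DoublingReturns (gFun eig A R) (ε / δ) μᵤ →
      BisectionReturns (gFun eig A R) (ε / δ) ξ μᵤ μ →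
      AlgorithmReturns eig A R ε δ ξ ((Real.sqrt δ : ℂ) • eig (A - (μ : ℂ) • R))

/-- `R` has a nontrivial kernel. -/
def HasKernel {N : ℕ} (R : CMat N) : Prop := ∃ f : CVec N, f ≠ 0 ∧ R *ᵥ f.ofLp = 0

/-- The principal eigenvalue of `A - μ R` is simple for every `μ ≥ 0`. -/
def NonDegenerate {N : ℕ} (A R : CMat N) : Prop :=
  ∀ μ : ℝ, 0 ≤ μ → HasSimplePrincipalEigenvalue (A - (μ : ℂ) • R)

end

/-!
The subcarrier problem is solved by Lagrangian duality. With multipliers `μ` for the interference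
constraint and `λ_max(A - μ R)` for the power constraint, both nonnegative, the point `√δ v` with
`v` a principal unit eigenvector of the pencil `A - μ R` is optimal up to the slackness term
`μ (ε - δ v^H R v)`. A kernel vector of `R` keeps `λ_max(A - μ R)` nonnegative because `A` is
positive semidefinite. This makes `μ g(μ) ≤ λ_max(A)`, so that `g` falls below `ε/δ` and the
doubling stops. If the principal eigenvalue of the pencil is simple, then `g` is continuous, so
that the bisection converges to a point where `g = ε/δ` and the slackness term vanishes. Stopping
with `|g(μ) - ε/δ| < ξ` instead costs at most `δ μᵤ ξ`, where the end value `μᵤ` of the doubling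
does not depend on `ξ`.
-/

open scoped ComplexOrder

section QuadRe

variable {N : ℕ}

lemma quadRe_add (M M' : CMat N) (f : CVec N) : quadRe (M + M') f = quadRe M f + quadRe M' f := by
  simp only [quadRe, add_mulVec, dotProduct_add, Complex.add_re]

lemma quadRe_sub (M M' : CMat N) (f : CVec N) : quadRe (M - M') f = quadRe M f - quadRe M' f := by
  simp only [quadRe, sub_mulVec, dotProduct_sub, Complex.sub_re]

lemma quadRe_ofReal_smul (t : ℝ) (M : CMat N) (f : CVec N) :
    quadRe ((t : ℂ) • M) f = t * quadRe M f := by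
  rw [quadRe, smul_mulVec, dotProduct_smul, smul_eq_mul, Complex.re_ofReal_mul, quadRe]

lemma quadRe_conjTranspose (M : CMat N) (f : CVec N) : quadRe Mᴴ f = quadRe M f := by
  have hstar : star (star f.ofLp ⬝ᵥ (M *ᵥ f.ofLp)) = star f.ofLp ⬝ᵥ (Mᴴ *ᵥ f.ofLp) := by
    rw [star_dotProduct, star_star, star_mulVec, dotProduct_mulVec]
  rw [quadRe, ← hstar, Complex.star_def, Complex.conj_re, quadRe]

lemma quadRe_one (f : CVec N) : quadRe 1 f = ‖f‖ ^ 2 := by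
  rw [quadRe, one_mulVec, dotProduct_comm, ← EuclideanSpace.inner_eq_star_dotProduct]
  exact inner_self_eq_norm_sq (𝕜 := ℂ) f

lemma quadRe_hermPart (C : CMat N) (f : CVec N) : quadRe (hermPart C) f = quadRe C f := by
  have hhalf : (1 / 2 : ℂ) = ((1 / 2 : ℝ) : ℂ) := by norm_num
  rw [hermPart, hhalf, quadRe_ofReal_smul, quadRe_add, quadRe_conjTranspose]
  ring

lemma quadRe_sub_smul (A R : CMat N) (μ : ℝ) (f : CVec N) :
    quadRe (A - (μ : ℂ) • R) f = quadRe A f - μ * quadRe R f := by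
  rw [quadRe_sub, quadRe_ofReal_smul]

lemma quadRe_zero (M : CMat N) : quadRe M 0 = 0 := by
  simp [quadRe]

lemma quadRe_smul (M : CMat N) (z : ℂ) (f : CVec N) :
    quadRe M (z • f) = ‖z‖ ^ 2 * quadRe M f := by
  rw [quadRe, WithLp.ofLp_smul, star_smul, mulVec_smul, dotProduct_smul, smul_dotProduct,
    smul_eq_mul, smul_eq_mul, ← mul_assoc, Complex.star_def, Complex.mul_conj,
    Complex.re_ofReal_mul, Complex.normSq_eq_norm_sq, quadRe]

lemma quadRe_sqrt_smul (M : CMat N) {δ : ℝ} (hδ : 0 ≤ δ) (f : CVec N) :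
    quadRe M ((Real.sqrt δ : ℂ) • f) = δ * quadRe M f := by
  rw [quadRe_smul, Complex.norm_real, Real.norm_eq_abs, sq_abs, Real.sq_sqrt hδ]

lemma norm_sqrt_smul_sq {δ : ℝ} (hδ : 0 ≤ δ) {f : CVec N} (hf : ‖f‖ = 1) :
    ‖(Real.sqrt δ : ℂ) • f‖ ^ 2 = δ := by
  rw [← quadRe_one, quadRe_sqrt_smul 1 hδ, quadRe_one, hf, one_pow, mul_one]

lemma quadRe_of_mulVec_eq_smul {M : CMat N} {f : CVec N} {t : ℝ}
    (hf : M *ᵥ f.ofLp = (t : ℂ) • f.ofLp) : quadRe M f = t * ‖f‖ ^ 2 := by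
  rw [← quadRe_one, ← quadRe_ofReal_smul, quadRe, hf, quadRe, smul_mulVec, one_mulVec]

lemma quadRe_nonneg_of_posSemidef {M : CMat N} (hM : M.PosSemidef) (f : CVec N) :
    0 ≤ quadRe M f :=
  hM.re_dotProduct_nonneg f.ofLp

lemma continuous_quadRe : Continuous fun p : CMat N × CVec N => quadRe p.1 p.2 := by
  unfold quadRe
  fun_prop

end QuadRe

section LambdaMax

variable {N : ℕ} {M : CMat N} {v : CVec N}

lemma isHermitian_sub_smul {A R : CMat N} (hA : A.IsHermitian) (hR : R.IsHermitian) (μ : ℝ) :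
    (A - (μ : ℂ) • R).IsHermitian :=
  hA.sub (hR.smul (Complex.conj_ofReal μ))

lemma finite_setOf_hasEigenvalue_ofReal (M : CMat N) :
    {t : ℝ | Module.End.HasEigenvalue (toLin' M) (t : ℂ)}.Finite :=
  (Module.End.finite_hasEigenvalue (toLin' M)).preimage Complex.ofReal_injective.injOn

lemma hasEigenvalue_eigenvalues (hM : M.IsHermitian) (i : Fin N) :
    Module.End.HasEigenvalue (toLin' M) (hM.eigenvalues i : ℂ) := by
  rw [Module.End.hasEigenvalue_iff_mem_spectrum, spectrum_toLin', hM.spectrum_eq_image_range]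
  exact Set.mem_image_of_mem _ (Set.mem_range_self i)

lemma eigenvalues_le_lambdaMax (hM : M.IsHermitian) (i : Fin N) :
    hM.eigenvalues i ≤ lambdaMax M :=
  le_csSup (finite_setOf_hasEigenvalue_ofReal M).bddAbove (hasEigenvalue_eigenvalues hM i)

lemma posSemidef_lambdaMax_smul_one_sub (hM : M.IsHermitian) :
    ((lambdaMax M : ℂ) • (1 : CMat N) - M).PosSemidef := by
  refine posSemidef_iff_isHermitian_and_spectrum_nonneg.2
    ⟨(isHermitian_one.smul (Complex.conj_ofReal _)).sub hM, ?_⟩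
  rw [← Algebra.algebraMap_eq_smul_one, ← spectrum.singleton_sub_eq, hM.spectrum_eq_image_range]
  rintro _ ⟨_, rfl, _, ⟨_, ⟨i, rfl⟩, rfl⟩, rfl⟩
  simpa using eigenvalues_le_lambdaMax hM i

lemma quadRe_lambdaMax_smul_one_sub (M : CMat N) (f : CVec N) :
    quadRe ((lambdaMax M : ℂ) • 1 - M) f = lambdaMax M * ‖f‖ ^ 2 - quadRe M f := by
  rw [quadRe_sub, quadRe_ofReal_smul, quadRe_one]

lemma quadRe_le_lambdaMax (hM : M.IsHermitian) (f : CVec N) :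
    quadRe M f ≤ lambdaMax M * ‖f‖ ^ 2 := by
  rw [← sub_nonneg, ← quadRe_lambdaMax_smul_one_sub]
  exact quadRe_nonneg_of_posSemidef (posSemidef_lambdaMax_smul_one_sub hM) f

lemma IsPrincipalUnitEigenvector.quadRe_eq (hv : IsPrincipalUnitEigenvector M v) :
    quadRe M v = lambdaMax M := by
  rw [quadRe_of_mulVec_eq_smul hv.2, hv.1, one_pow, mul_one]

lemma isPrincipalUnitEigenvector_iff_quadRe_eq (hM : M.IsHermitian) :
    IsPrincipalUnitEigenvector M v ↔ ‖v‖ = 1 ∧ quadRe M v = lambdaMax M := by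
  refine ⟨fun hv => ⟨hv.1, hv.quadRe_eq⟩, fun ⟨hv, hq⟩ => ⟨hv, ?_⟩⟩
  set S : CMat N := (lambdaMax M : ℂ) • 1 - M
  have hS : S.PosSemidef := posSemidef_lambdaMax_smul_one_sub hM
  have hre : (star v.ofLp ⬝ᵥ (S *ᵥ v.ofLp)).re = 0 := by
    rw [← quadRe, quadRe_lambdaMax_smul_one_sub, hv, hq, one_pow, mul_one, sub_self]
  have hzero : star v.ofLp ⬝ᵥ (S *ᵥ v.ofLp) = 0 :=
    Complex.ext hre (Complex.le_def.1 (hS.dotProduct_mulVec_nonneg v.ofLp)).2.symm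
  have hker : S *ᵥ v.ofLp = 0 := (hS.dotProduct_mulVec_zero_iff _).1 hzero
  rwa [sub_mulVec, smul_mulVec, one_mulVec, sub_eq_zero, eq_comm] at hker

lemma exists_isPrincipalUnitEigenvector [NeZero N] (hM : M.IsHermitian) :
    ∃ u, IsPrincipalUnitEigenvector M u := by
  have hmax : Module.End.HasEigenvalue (toLin' M) (lambdaMax M : ℂ) :=
    Set.Nonempty.csSup_mem (s := {t : ℝ | Module.End.HasEigenvalue (toLin' M) (t : ℂ)})
      ⟨_, hasEigenvalue_eigenvalues hM 0⟩ (finite_setOf_hasEigenvalue_ofReal M)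
  obtain ⟨x, hx⟩ := hmax.exists_hasEigenvector
  have hx0 : WithLp.toLp 2 x ≠ 0 := by simpa using hx.2
  refine ⟨((‖WithLp.toLp 2 x‖⁻¹ : ℝ) : ℂ) • WithLp.toLp 2 x, ?_, ?_⟩
  · rw [Complex.coe_smul, norm_smul, norm_inv, norm_norm, inv_mul_cancel₀ (norm_ne_zero_iff.2 hx0)]
  · rw [WithLp.ofLp_smul, mulVec_smul, ← toLin'_apply, hx.apply_eq_smul, smul_comm]

lemma isPrincipalUnitEigenvector_iff_forall_quadRe_le (hM : M.IsHermitian) :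
    IsPrincipalUnitEigenvector M v ↔
      ‖v‖ = 1 ∧ ∀ u : CVec N, ‖u‖ = 1 → quadRe M u ≤ quadRe M v := by
  refine ⟨fun hv => ⟨hv.1, fun u hu => ?_⟩, fun ⟨hv, hmax⟩ => ?_⟩
  · simpa [hv.quadRe_eq, hu] using quadRe_le_lambdaMax hM u
  · have : NeZero N := ⟨by rintro rfl; simp [Subsingleton.elim v 0] at hv⟩
    obtain ⟨u, hu⟩ := exists_isPrincipalUnitEigenvector hM
    refine (isPrincipalUnitEigenvector_iff_quadRe_eq hM).2 ⟨hv, le_antisymm ?_ ?_⟩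
    · simpa [hv] using quadRe_le_lambdaMax hM v
    · exact hu.quadRe_eq ▸ hmax u hu.1

lemma isClosed_setOf_isPrincipalUnitEigenvector :
    IsClosed {p : CMat N × CVec N | p.1.IsHermitian ∧ IsPrincipalUnitEigenvector p.1 p.2} := by
  have hset : {p : CMat N × CVec N | p.1.IsHermitian ∧ IsPrincipalUnitEigenvector p.1 p.2} =
      {p | p.1ᴴ = p.1} ∩ ({p | ‖p.2‖ = 1} ∩
        ⋂ u : CVec N, ⋂ _ : ‖u‖ = 1, {p | quadRe p.1 u ≤ quadRe p.1 p.2}) := by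
    ext p
    simp only [Set.mem_ofPred_eq, Set.mem_inter_iff, Set.mem_iInter]
    exact and_congr_right isPrincipalUnitEigenvector_iff_forall_quadRe_le
  rw [hset]
  refine (isClosed_eq (by fun_prop) continuous_fst).inter
    ((isClosed_eq (by fun_prop) continuous_const).inter
      (isClosed_iInter fun u => isClosed_iInter fun _ => isClosed_le ?_ continuous_quadRe))
  exact continuous_quadRe.comp (continuous_fst.prodMk continuous_const)

lemma HasSimplePrincipalEigenvalue.exists_eq_smul (hM : HasSimplePrincipalEigenvalue M)
    {w : CVec N} (hv : IsPrincipalUnitEigenvector M v) (hw : IsPrincipalUnitEigenvector M w) :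
    ∃ z : ℂ, ‖z‖ = 1 ∧ w = z • v := by
  have hmem {x : CVec N} (hx : IsPrincipalUnitEigenvector M x) :
      x.ofLp ∈ Module.End.eigenspace (toLin' M) (lambdaMax M : ℂ) :=
    Module.End.mem_eigenspace_iff.2 (by rw [toLin'_apply, hx.2])
  have hv0 : (⟨v.ofLp, hmem hv⟩ : Module.End.eigenspace (toLin' M) (lambdaMax M : ℂ)) ≠ 0 := by
    rw [Ne, Submodule.mk_eq_zero, WithLp.ofLp_eq_zero, ← norm_eq_zero, hv.1]
    exact one_ne_zero
  obtain ⟨z, hz⟩ := (finrank_eq_one_iff_of_nonzero' _ hv0).1 hM ⟨w.ofLp, hmem hw⟩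
  have hzw : w = z • v := WithLp.ofLp_injective 2 (congrArg Subtype.val hz).symm
  exact ⟨z, by simpa [hzw, norm_smul, hv.1] using hw.1, hzw⟩

lemma HasSimplePrincipalEigenvalue.quadRe_eq (hM : HasSimplePrincipalEigenvalue M)
    {w : CVec N} (hv : IsPrincipalUnitEigenvector M v) (hw : IsPrincipalUnitEigenvector M w)
    (R : CMat N) : quadRe R w = quadRe R v := by
  obtain ⟨z, hz, rfl⟩ := hM.exists_eq_smul hv hw
  rw [quadRe_smul, hz, one_pow, one_mul]

-- By compactness of the sphere the routine has cluster values, which are principal unit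
-- eigenvectors because these form a closed graph, and a simple eigenvalue leaves only one value of
-- the form `R` on them.
lemma IsEigRoutine.continuousWithinAt_quadRe {eig : CMat N → CVec N} (he : IsEigRoutine eig)
    (hM : M.IsHermitian) (hs : HasSimplePrincipalEigenvalue M) (R : CMat N) :
    ContinuousWithinAt (fun M' => quadRe R (eig M')) {M' | M'.IsHermitian} M := by
  refine (tendsto_iff_ultrafilter _ _ _).2 fun U hU => ?_
  have hherm : ∀ᶠ M' : CMat N in U, M'.IsHermitian := hU self_mem_nhdsWithin
  have hsphere : ∀ᶠ M' in U, eig M' ∈ Metric.sphere 0 1 :=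
    hherm.mono fun M' hM' => by simpa using (he M' hM').1
  obtain ⟨w, -, hw⟩ := (isCompact_sphere (0 : CVec N) 1).ultrafilter_le_nhds' (U.map eig) hsphere
  have hlim : Tendsto eig U (𝓝 w) := hw
  have hid : Tendsto (fun M' : CMat N => M') U (𝓝 M) := hU.trans nhdsWithin_le_nhds
  have hwM : IsPrincipalUnitEigenvector M w :=
    (isClosed_setOf_isPrincipalUnitEigenvector.mem_of_tendsto (hid.prodMk_nhds hlim)
      (hherm.mono fun M' hM' => ⟨hM', he M' hM'⟩)).2
  have hcont : Continuous (quadRe R) :=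
    continuous_quadRe.comp (continuous_const.prodMk continuous_id)
  have hval : quadRe R w = quadRe R (eig M) := hs.quadRe_eq (he M hM) hwM R
  change Tendsto _ _ (𝓝 (quadRe R (eig M)))
  exact hval ▸ (hcont.tendsto w).comp hlim

end LambdaMax

section Data

lemma isHermitian_RPu {N Npu : ℕ} (Psb : ℝ) (h : Fin Npu → CVec N) : (RPu Psb h).IsHermitian :=
  (posSemidef_sum _ fun _ _ => posSemidef_vecMulVec_star_self _).1.smul (Complex.conj_ofReal _)

lemma hermPart_eq_self {N : ℕ} {C : CMat N} (hC : C.IsHermitian) : hermPart C = C := by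
  rw [hermPart, hC.eq, ← two_smul ℂ C, smul_smul, one_div_mul_cancel two_ne_zero, one_smul]

variable {Γ : Type*} [MeasurableSpace Γ] {P : Measure Γ}

lemma posSemidef_integral {n 𝕜 : Type*} [Finite n] [RCLike 𝕜] {F : Γ → Matrix n n 𝕜}
    (hint : ∀ i j, Integrable (fun γ => F γ i j) P) (hF : ∀ᵐ γ ∂P, (F γ).PosSemidef) :
    (Matrix.of fun i j => ∫ γ, F γ i j ∂P).PosSemidef := by
  have := Fintype.ofFinite n
  refine .of_dotProduct_mulVec_nonneg ?_ fun x => ?_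
  · ext i j
    rw [conjTranspose_apply, of_apply, of_apply, RCLike.star_def, ← integral_conj]
    exact integral_congr_ae (hF.mono fun γ hγ => hγ.1.apply i j)
  · have hform : star x ⬝ᵥ ((Matrix.of fun i j => ∫ γ, F γ i j ∂P) *ᵥ x) =
        ∫ γ, star x ⬝ᵥ (F γ *ᵥ x) ∂P := by
      have hrow i j := (hint i j).mul_const (x j)
      have hsum i := (integrable_finsetSum Finset.univ fun j _ => hrow i j).const_mul (star x i)
      simp only [dotProduct, mulVec, of_apply]
      rw [integral_finsetSum _ fun i _ => hsum i]
      refine Finset.sum_congr rfl fun i _ => ?_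
      rw [integral_const_mul, integral_finsetSum _ fun j _ => hrow i j]
      simp only [integral_mul_const]
    rw [hform]
    exact integral_nonneg_of_ae (hF.mono fun γ hγ => hγ.dotProduct_mulVec_nonneg x)

lemma integrable_vecMulVec_star_self {n 𝕜 : Type*} [Fintype n] [RCLike 𝕜]
    {X : Γ → EuclideanSpace 𝕜 n} (hX : MemLp X 2 P) (i j : n) :
    Integrable (fun γ => vecMulVec (star (X γ).ofLp) (X γ).ofLp i j) P := by
  have hcoord k : MemLp (fun γ => X γ k) 2 P :=
    (PiLp.proj 2 (fun _ : n => 𝕜) k : EuclideanSpace 𝕜 n →L[𝕜] 𝕜).comp_memLp' hX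
  exact (hcoord i).star.integrable_mul (hcoord j)

variable {N : ℕ}

lemma memLp_cBar {p : ENNReal} {c : Fin 5 → Γ → CVec N} (hc : ∀ r, MemLp (c r) p P)
    (d : Fin 5 → ℝ) : MemLp (cBar c d) p P :=
  memLp_finsetSum _ fun r _ => (hc r).const_smul (d r : ℂ)

lemma posSemidef_CBar (σ : ℝ) {c : Fin 5 → Γ → CVec N} (hc : ∀ r, MemLp (c r) 2 P)
    (d : Fin 3 → Fin 5 → ℝ) : (CBar P σ c d).PosSemidef := by
  have hσ : (0 : ℂ) ≤ ((2 / σ ^ 2 : ℝ) : ℂ) := by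
    rw [Complex.zero_le_real]
    positivity
  exact posSemidef_sum _ fun j _ => posSemidef_integral
    (F := fun γ => ((2 / σ ^ 2 : ℝ) : ℂ) • vecMulVec (star (cBar c (d j) γ).ofLp) _)
    (fun m n => (integrable_vecMulVec_star_self (memLp_cBar hc (d j)) m n).const_mul _)
    (ae_of_all _ fun γ => (posSemidef_vecMulVec_star_self _).smul hσ)

lemma posSemidef_hermPart_CBar (σ : ℝ) {c : Fin 5 → Γ → CVec N} (hc : ∀ r, MemLp (c r) 2 P)
    (d : Fin 3 → Fin 5 → ℝ) : (hermPart (CBar P σ c d)).PosSemidef :=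
  (hermPart_eq_self (posSemidef_CBar σ hc d).1).symm ▸ posSemidef_CBar σ hc d

end Data

section Doubling

variable {g : ℝ → ℝ} {t : ℝ}

lemma exists_doublingReturns (hg : ∀ᶠ x in atTop, g x ≤ t) : ∃ μᵤ, DoublingReturns g t μᵤ := by
  classical
  have hex : ∃ k : ℕ, g (2 ^ k) ≤ t :=
    ((tendsto_pow_atTop_atTop_of_one_lt one_lt_two).eventually hg).exists
  exact ⟨_, Nat.find hex, rfl, Nat.find_spec hex, fun m hm => not_le.1 (Nat.find_min hex hm)⟩

lemma DoublingReturns.pos {μᵤ : ℝ} (h : DoublingReturns g t μᵤ) : 0 < μᵤ := by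
  obtain ⟨k, rfl, -⟩ := h
  positivity

lemma DoublingReturns.apply_le {μᵤ : ℝ} (h : DoublingReturns g t μᵤ) : g μᵤ ≤ t := by
  obtain ⟨k, rfl, hk, -⟩ := h
  exact hk

lemma DoublingReturns.unique {a b : ℝ} (ha : DoublingReturns g t a) (hb : DoublingReturns g t b) :
    a = b := by
  obtain ⟨k, rfl, hk, hk'⟩ := ha
  obtain ⟨l, rfl, hl, hl'⟩ := hb
  rcases lt_trichotomy k l with h | rfl | h
  · exact absurd (hl' k h) hk.not_gt
  · rfl
  · exact absurd (hk' l h) hl.not_gt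

lemma exists_forall_doublingReturns_le (g : ℝ → ℝ) (t : ℝ) :
    ∃ K, 0 ≤ K ∧ ∀ μᵤ, DoublingReturns g t μᵤ → μᵤ ≤ K := by
  by_cases h : ∃ a, DoublingReturns g t a
  · obtain ⟨a, ha⟩ := h
    exact ⟨a, ha.pos.le, fun b hb => (hb.unique ha).le⟩
  · exact ⟨0, le_rfl, fun b hb => absurd ⟨b, hb⟩ h⟩

end Doubling

section Bisection

variable {g : ℝ → ℝ} {t : ℝ} {s : ℝ × ℝ}

/-- The invariant of the bisection: `s` is an interval on which `g` passes from above `t` at the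
left end to at most `t` at the right end. -/
structure IsBracket (g : ℝ → ℝ) (t : ℝ) (s : ℝ × ℝ) : Prop where
  fst_le_snd : s.1 ≤ s.2
  lt_apply_fst : t < g s.1
  apply_snd_le : g s.2 ≤ t

lemma bracketMid_mem_Icc (hs : s.1 ≤ s.2) : bracketMid s ∈ Set.Icc s.1 s.2 := by
  unfold bracketMid
  constructor <;> linarith

lemma Icc_bisectStep_subset (g : ℝ → ℝ) (t : ℝ) (hs : s.1 ≤ s.2) :
    Set.Icc (bisectStep g t s).1 (bisectStep g t s).2 ⊆ Set.Icc s.1 s.2 := by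
  have hmid := bracketMid_mem_Icc hs
  unfold bisectStep
  split_ifs
  · exact Set.Icc_subset_Icc_left hmid.1
  · exact Set.Icc_subset_Icc_right hmid.2

lemma bisectStep_snd_sub_fst (g : ℝ → ℝ) (t : ℝ) (s : ℝ × ℝ) :
    (bisectStep g t s).2 - (bisectStep g t s).1 = (s.2 - s.1) / 2 := by
  unfold bisectStep bracketMid
  split_ifs <;> ring

lemma iterate_bisectStep_snd_sub_fst (g : ℝ → ℝ) (t : ℝ) (s : ℝ × ℝ) (k : ℕ) :
    ((bisectStep g t)^[k] s).2 - ((bisectStep g t)^[k] s).1 = (s.2 - s.1) / 2 ^ k := by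
  induction k with
  | zero => simp
  | succ k ih => rw [Function.iterate_succ_apply', bisectStep_snd_sub_fst, ih, pow_succ, div_div]

lemma isBracket_bisectStep (hs : IsBracket g t s) : IsBracket g t (bisectStep g t s) := by
  have hmid := bracketMid_mem_Icc hs.fst_le_snd
  unfold bisectStep
  split_ifs with h
  · exact ⟨hmid.2, h, hs.apply_snd_le⟩
  · exact ⟨hmid.1, hs.lt_apply_fst, not_lt.1 h⟩

lemma isBracket_iterate_bisectStep (hs : IsBracket g t s) (k : ℕ) :
    IsBracket g t ((bisectStep g t)^[k] s) := by
  induction k with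
  | zero => exact hs
  | succ k ih => exact Function.iterate_succ_apply' (bisectStep g t) k s ▸ isBracket_bisectStep ih

lemma IsBracket.antitone_Icc_iterate (hs : IsBracket g t s) :
    Antitone fun k => Set.Icc ((bisectStep g t)^[k] s).1 ((bisectStep g t)^[k] s).2 := by
  refine antitone_nat_of_succ_le fun k => ?_
  rw [Function.iterate_succ_apply']
  exact Icc_bisectStep_subset g t (isBracket_iterate_bisectStep hs k).fst_le_snd

lemma IsBracket.Icc_iterate_subset (hs : IsBracket g t s) (k : ℕ) :
    Set.Icc ((bisectStep g t)^[k] s).1 ((bisectStep g t)^[k] s).2 ⊆ Set.Icc s.1 s.2 :=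
  hs.antitone_Icc_iterate k.zero_le

lemma IsBracket.bracketMid_iterate_mem_Icc (hs : IsBracket g t s) (k : ℕ) :
    bracketMid ((bisectStep g t)^[k] s) ∈
      Set.Icc ((bisectStep g t)^[k] s).1 ((bisectStep g t)^[k] s).2 :=
  bracketMid_mem_Icc (isBracket_iterate_bisectStep hs k).fst_le_snd

lemma IsBracket.exists_forall_tendsto (hs : IsBracket g t s) :
    ∃ μ ∈ Set.Icc s.1 s.2, ∀ y : ℕ → ℝ,
      (∀ k, y k ∈ Set.Icc ((bisectStep g t)^[k] s).1 ((bisectStep g t)^[k] s).2) →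
        Tendsto y atTop (𝓝 μ) := by
  have hμ := Set.mem_iInter.1 <| ciSup_mem_iInter_Icc_of_antitone_Icc hs.antitone_Icc_iterate
    fun k => (isBracket_iterate_bisectStep hs k).fst_le_snd
  refine ⟨_, hμ 0, fun y hy => ?_⟩
  set μ := ⨆ k, ((bisectStep g t)^[k] s).1
  have hdist (k : ℕ) : dist (y k) μ ≤ (s.2 - s.1) / 2 ^ k :=
    iterate_bisectStep_snd_sub_fst g t s k ▸ Real.dist_le_of_mem_Icc (hy k) (hμ k)
  have hwidth : Tendsto (fun k : ℕ => (s.2 - s.1) / 2 ^ k) atTop (𝓝 0) :=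
    tendsto_const_nhds.div_atTop (tendsto_pow_atTop_atTop_of_one_lt one_lt_two)
  exact tendsto_iff_dist_tendsto_zero.2 (squeeze_zero (fun _ => dist_nonneg) hdist hwidth)

lemma IsBracket.exists_tendsto_bracketMid (hs : IsBracket g t s)
    (hg : ContinuousOn g (Set.Icc s.1 s.2)) :
    ∃ μ ∈ Set.Ioc s.1 s.2, g μ = t ∧
      Tendsto (fun k => bracketMid ((bisectStep g t)^[k] s)) atTop (𝓝 μ) ∧
      Tendsto (fun k => g (bracketMid ((bisectStep g t)^[k] s))) atTop (𝓝 t) := by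
  obtain ⟨μ, hμ, hlim⟩ := hs.exists_forall_tendsto
  have hbr := isBracket_iterate_bisectStep hs
  have hglim (y : ℕ → ℝ)
      (hy : ∀ k, y k ∈ Set.Icc ((bisectStep g t)^[k] s).1 ((bisectStep g t)^[k] s).2) :
      Tendsto (fun k => g (y k)) atTop (𝓝 (g μ)) :=
    (hg μ hμ).tendsto.comp <| tendsto_nhdsWithin_iff.2
      ⟨hlim y hy, Eventually.of_forall fun k => hs.Icc_iterate_subset k (hy k)⟩
  have hge : t ≤ g μ :=
    ge_of_tendsto' (hglim _ fun k => Set.left_mem_Icc.2 (hbr k).fst_le_snd)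
      fun k => (hbr k).lt_apply_fst.le
  have hle : g μ ≤ t :=
    le_of_tendsto' (hglim _ fun k => Set.right_mem_Icc.2 (hbr k).fst_le_snd)
      fun k => (hbr k).apply_snd_le
  have hgμ : g μ = t := hle.antisymm hge
  have hne : s.1 ≠ μ := fun h => hs.lt_apply_fst.not_ge (h ▸ hle)
  have hgmid := hglim _ hs.bracketMid_iterate_mem_Icc
  rw [hgμ] at hgmid
  exact ⟨μ, ⟨hμ.1.lt_of_ne hne, hμ.2⟩, hgμ, hlim _ hs.bracketMid_iterate_mem_Icc, hgmid⟩

lemma exists_bisectionReturns {μᵤ ξ : ℝ} (hξ : 0 < ξ)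
    (hlim : Tendsto (fun k => g (bisectMid g t μᵤ k)) atTop (𝓝 t)) :
    ∃ μ, BisectionReturns g t ξ μᵤ μ := by
  classical
  have hex : ∃ k, |g (bisectMid g t μᵤ k) - t| < ξ :=
    (hlim.eventually (Metric.ball_mem_nhds t hξ)).exists
  exact ⟨_, Nat.find hex, rfl, Nat.find_spec hex, fun m hm => not_lt.1 (Nat.find_min hex hm)⟩

lemma BisectionReturns.abs_sub_lt {μᵤ ξ μ : ℝ} (h : BisectionReturns g t ξ μᵤ μ) :
    |g μ - t| < ξ := by
  obtain ⟨k, rfl, hk, -⟩ := h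
  exact hk

lemma DoublingReturns.isBracket {μᵤ : ℝ} (h : DoublingReturns g t μᵤ) (h0 : t < g 0) :
    IsBracket g t (0, μᵤ) :=
  ⟨h.pos.le, h0, h.apply_le⟩

lemma BisectionReturns.mem_Icc {μᵤ ξ μ : ℝ} (h : BisectionReturns g t ξ μᵤ μ)
    (hs : IsBracket g t (0, μᵤ)) : μ ∈ Set.Icc 0 μᵤ := by
  obtain ⟨k, rfl, -⟩ := h
  exact hs.Icc_iterate_subset k (hs.bracketMid_iterate_mem_Icc k)

end Bisection

section Subcarrier

variable {N : ℕ} {A R : CMat N} {ε δ μ : ℝ} {u v f : CVec N}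

lemma lambdaMax_sub_smul_nonneg (hA : A.PosSemidef) (hR : R.IsHermitian) (hK : HasKernel R)
    (μ : ℝ) : 0 ≤ lambdaMax (A - (μ : ℂ) • R) := by
  obtain ⟨f, hf, hRf⟩ := hK
  have hR0 : quadRe R f = 0 := by rw [quadRe, hRf, dotProduct_zero, Complex.zero_re]
  have hq : quadRe (A - (μ : ℂ) • R) f = quadRe A f := by
    rw [quadRe_sub_smul, hR0, mul_zero, sub_zero]
  have hle : 0 ≤ lambdaMax (A - (μ : ℂ) • R) * ‖f‖ ^ 2 :=
    calc 0 ≤ quadRe A f := quadRe_nonneg_of_posSemidef hA f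
      _ = quadRe (A - (μ : ℂ) • R) f := hq.symm
      _ ≤ _ := quadRe_le_lambdaMax (isHermitian_sub_smul hA.1 hR μ) f
  exact nonneg_of_mul_nonneg_left hle (pow_pos (norm_pos_iff.2 hf) 2)

-- Weak Lagrangian duality: the gap is the complementary slackness term of the first constraint.
lemma quadRe_le_quadRe_sqrt_smul_add (hA : A.IsHermitian) (hR : R.IsHermitian) (hδ : 0 ≤ δ)
    (hμ : 0 ≤ μ) (hL : 0 ≤ lambdaMax (A - (μ : ℂ) • R))
    (hv : IsPrincipalUnitEigenvector (A - (μ : ℂ) • R) v) (hf : f ∈ feasible R ε δ) :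
    quadRe A f ≤ quadRe A ((Real.sqrt δ : ℂ) • v) + μ * (ε - δ * quadRe R v) := by
  set L := lambdaMax (A - (μ : ℂ) • R)
  have hfL : quadRe A f - μ * quadRe R f ≤ L * ‖f‖ ^ 2 := by
    rw [← quadRe_sub_smul]
    exact quadRe_le_lambdaMax (isHermitian_sub_smul hA hR μ) f
  have hvL : quadRe A v - μ * quadRe R v = L := by
    rw [← quadRe_sub_smul, hv.quadRe_eq]
  calc quadRe A f ≤ L * ‖f‖ ^ 2 + μ * quadRe R f := by linarith
    _ ≤ L * δ + μ * ε := by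
      gcongr
      exacts [hf.2, hf.1]
    _ = quadRe A ((Real.sqrt δ : ℂ) • v) + μ * (ε - δ * quadRe R v) := by
      rw [quadRe_sqrt_smul A hδ, ← hvL]
      ring

lemma isSubcarrierSolution_hermPart {C : CMat N} :
    IsSubcarrierSolution (hermPart C) R ε δ f ↔ IsSubcarrierSolution C R ε δ f := by
  rw [IsSubcarrierSolution, IsSubcarrierSolution, funext (quadRe_hermPart C)]

lemma isSubcarrierSolution_zero (hA : A.IsHermitian) (hε : 0 ≤ ε) (hδ : 0 ≤ δ)
    (hL : lambdaMax A ≤ 0) : IsSubcarrierSolution A R ε δ 0 := by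
  refine ⟨⟨by rwa [quadRe_zero], by simpa using hδ⟩, fun f _ => ?_⟩
  calc quadRe A f ≤ lambdaMax A * ‖f‖ ^ 2 := quadRe_le_lambdaMax hA f
    _ ≤ 0 := mul_nonpos_of_nonpos_of_nonneg hL (by positivity)
    _ = quadRe A 0 := (quadRe_zero A).symm

lemma isSubcarrierSolution_sqrt_smul (hA : A.IsHermitian) (hR : R.IsHermitian) (hδ : 0 < δ)
    (hμ : 0 ≤ μ) (hL : 0 ≤ lambdaMax (A - (μ : ℂ) • R))
    (hv : IsPrincipalUnitEigenvector (A - (μ : ℂ) • R) v) (hle : quadRe R v ≤ ε / δ)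
    (hslack : μ = 0 ∨ quadRe R v = ε / δ) :
    IsSubcarrierSolution A R ε δ ((Real.sqrt δ : ℂ) • v) := by
  refine ⟨⟨?_, (norm_sqrt_smul_sq hδ.le hv.1).le⟩, fun f hf => ?_⟩
  · rw [quadRe_sqrt_smul R hδ.le]
    exact (le_div_iff₀' hδ).1 hle
  · have hgap : μ * (ε - δ * quadRe R v) = 0 := by
      rcases hslack with rfl | hq
      · exact zero_mul _
      · rw [hq, mul_div_cancel₀ _ hδ.ne', sub_self, mul_zero]
    simpa [hgap] using quadRe_le_quadRe_sqrt_smul_add hA hR hδ.le hμ hL hv hf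

lemma isSubcarrierSolution_sqrt_smul_principal (hA : A.IsHermitian) (hR : R.IsHermitian)
    (hδ : 0 < δ) (hL : 0 ≤ lambdaMax A) (hu : IsPrincipalUnitEigenvector A u)
    (hle : quadRe R u ≤ ε / δ) : IsSubcarrierSolution A R ε δ ((Real.sqrt δ : ℂ) • u) := by
  have hA0 : A - ((0 : ℝ) : ℂ) • R = A := by rw [Complex.ofReal_zero, zero_smul, sub_zero]
  exact isSubcarrierSolution_sqrt_smul hA hR hδ le_rfl (by rwa [hA0]) (by rwa [hA0]) hle (.inl rfl)

end Subcarrier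

section Algorithm

variable {N : ℕ} {A R : CMat N} {ε δ ξ t : ℝ} {eig : CMat N → CVec N} {f F : CVec N}

lemma gFun_zero (eig : CMat N → CVec N) (A R : CMat N) : gFun eig A R 0 = quadRe R (eig A) := by
  simp [gFun]

lemma continuousOn_gFun (he : IsEigRoutine eig) (hA : A.IsHermitian) (hR : R.IsHermitian)
    (hnd : NonDegenerate A R) : ContinuousOn (gFun eig A R) (Set.Ici 0) := by
  intro μ hμ
  have hpencil : Continuous fun μ : ℝ => A - (μ : ℂ) • R := by fun_prop
  exact ContinuousWithinAt.comp (g := fun M => quadRe R (eig M)) (t := {M | M.IsHermitian})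
    (he.continuousWithinAt_quadRe (isHermitian_sub_smul hA hR μ) (hnd μ hμ) R)
    hpencil.continuousWithinAt fun ν _ => isHermitian_sub_smul hA hR ν

lemma mul_gFun_le_lambdaMax (he : IsEigRoutine eig) (hA : A.PosSemidef) (hR : R.IsHermitian)
    (hK : HasKernel R) (μ : ℝ) : μ * gFun eig A R μ ≤ lambdaMax A := by
  have hv := he _ (isHermitian_sub_smul hA.1 hR μ)
  have hL : 0 ≤ quadRe A (eig (A - (μ : ℂ) • R)) - μ * gFun eig A R μ := by
    rw [gFun, ← quadRe_sub_smul, hv.quadRe_eq]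
    exact lambdaMax_sub_smul_nonneg hA hR hK μ
  have hAv := quadRe_le_lambdaMax hA.1 (eig (A - (μ : ℂ) • R))
  rw [hv.1, one_pow, mul_one] at hAv
  linarith

lemma eventually_gFun_le (he : IsEigRoutine eig) (hA : A.PosSemidef) (hR : R.IsHermitian)
    (hK : HasKernel R) (ht : 0 < t) : ∀ᶠ μ in atTop, gFun eig A R μ ≤ t := by
  filter_upwards [eventually_gt_atTop 0, eventually_ge_atTop (lambdaMax A / t)] with μ hμ hμt
  refine le_of_mul_le_mul_left ?_ hμ
  exact (mul_gFun_le_lambdaMax he hA hR hK μ).trans ((div_le_iff₀ ht).1 hμt)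

lemma exists_doublingReturns_tendsto_bisectMid (he : IsEigRoutine eig) (hA : A.PosSemidef)
    (hR : R.IsHermitian) (hK : HasKernel R) (hnd : NonDegenerate A R) (ht : 0 < t)
    (hu : t < quadRe R (eig A)) :
    ∃ μᵤ, DoublingReturns (gFun eig A R) t μᵤ ∧ ∃ μ, 0 < μ ∧ gFun eig A R μ = t ∧
      Tendsto (bisectMid (gFun eig A R) t μᵤ) atTop (𝓝 μ) ∧
      Tendsto (fun k => gFun eig A R (bisectMid (gFun eig A R) t μᵤ k)) atTop (𝓝 t) := by
  obtain ⟨μᵤ, hμᵤ⟩ := exists_doublingReturns (eventually_gFun_le he hA hR hK ht)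
  have hbracket := hμᵤ.isBracket (gFun_zero eig A R ▸ hu)
  obtain ⟨μ, hμ, hg, hlim, hglim⟩ := hbracket.exists_tendsto_bracketMid
    ((continuousOn_gFun he hA.1 hR hnd).mono Set.Icc_subset_Ici_self)
  exact ⟨μᵤ, hμᵤ, μ, hμ.1, hg, hlim, hglim⟩

lemma exists_algorithmReturns (he : IsEigRoutine eig) (hA : A.PosSemidef) (hR : R.IsHermitian)
    (hε : 0 < ε) (hδ : 0 < δ)
    (hlast : 0 < lambdaMax A → ε / δ < quadRe R (eig A) → HasKernel R ∧ NonDegenerate A R)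
    (hξ : 0 < ξ) : ∃ F, AlgorithmReturns eig A R ε δ ξ F := by
  rcases le_or_gt (lambdaMax A) 0 with hL | hL
  · exact ⟨_, .zero hL⟩
  rcases le_or_gt (quadRe R (eig A)) (ε / δ) with hu | hu
  · exact ⟨_, .principal hL hu⟩
  obtain ⟨hK, hnd⟩ := hlast hL hu
  obtain ⟨μᵤ, hμᵤ, -, -, -, -, hlim⟩ :=
    exists_doublingReturns_tendsto_bisectMid he hA hR hK hnd (div_pos hε hδ) hu
  obtain ⟨μ, hμ⟩ := exists_bisectionReturns hξ hlim
  exact ⟨_, .bisection μᵤ μ hL hu hμᵤ hμ⟩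

lemma AlgorithmReturns.eq_zero_or_eq_sqrt_smul (he : IsEigRoutine eig) (hA : A.IsHermitian)
    (hR : R.IsHermitian) (hξ : 0 ≤ ξ) (hF : AlgorithmReturns eig A R ε δ ξ F) :
    F = 0 ∨ ∃ v, ‖v‖ = 1 ∧ quadRe R v ≤ ε / δ + ξ ∧ F = (Real.sqrt δ : ℂ) • v := by
  cases hF with
  | zero _ => exact .inl rfl
  | principal _ hu => exact .inr ⟨_, (he A hA).1, hu.trans (le_add_of_nonneg_right hξ), rfl⟩
  | bisection _ μ _ _ _ hμ =>
    have hg : gFun eig A R μ ≤ ε / δ + ξ := sub_le_iff_le_add'.1 (abs_lt.1 hμ.abs_sub_lt).2.le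
    exact .inr ⟨_, (he _ (isHermitian_sub_smul hA hR μ)).1, hg, rfl⟩

lemma AlgorithmReturns.mem_feasible (he : IsEigRoutine eig) (hA : A.IsHermitian)
    (hR : R.IsHermitian) (hε : 0 ≤ ε) (hδ : 0 < δ) (hξ : 0 ≤ ξ)
    (hF : AlgorithmReturns eig A R ε δ ξ F) : F ∈ feasible R (ε + δ * ξ) δ := by
  rcases hF.eq_zero_or_eq_sqrt_smul he hA hR hξ with rfl | ⟨v, hv, hq, rfl⟩
  · refine ⟨?_, by simpa using hδ.le⟩
    rw [quadRe_zero]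
    positivity
  · refine ⟨?_, (norm_sqrt_smul_sq hδ.le hv).le⟩
    calc quadRe R ((Real.sqrt δ : ℂ) • v) = δ * quadRe R v := quadRe_sqrt_smul R hδ.le v
      _ ≤ δ * (ε / δ + ξ) := by gcongr
      _ = ε + δ * ξ := by rw [mul_add, mul_div_cancel₀ _ hδ.ne']

lemma AlgorithmReturns.quadRe_le_add {K : ℝ} (he : IsEigRoutine eig) (hA : A.PosSemidef)
    (hR : R.IsHermitian) (hε : 0 ≤ ε) (hδ : 0 < δ)
    (hlast : 0 < lambdaMax A → ε / δ < quadRe R (eig A) → HasKernel R)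
    (hK : 0 ≤ K) (hμK : ∀ μᵤ, DoublingReturns (gFun eig A R) (ε / δ) μᵤ → μᵤ ≤ K) (hξ : 0 ≤ ξ)
    (hF : AlgorithmReturns eig A R ε δ ξ F) (hf : f ∈ feasible R ε δ) :
    quadRe A f ≤ quadRe A F + δ * K * ξ := by
  have hloss : 0 ≤ δ * K * ξ := by positivity
  cases hF with
  | zero hL =>
    exact le_add_of_le_of_nonneg ((isSubcarrierSolution_zero hA.1 hε hδ.le hL).2 hf) hloss
  | principal hL hu =>
    have hsol := isSubcarrierSolution_sqrt_smul_principal hA.1 hR hδ hL.le (he A hA.1) hu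
    exact le_add_of_le_of_nonneg (hsol.2 hf) hloss
  | bisection μᵤ μ hL hu hμᵤ hμ =>
    obtain ⟨hμ0, hμle⟩ := hμ.mem_Icc (hμᵤ.isBracket (gFun_zero eig A R ▸ hu))
    have hv := he _ (isHermitian_sub_smul hA.1 hR μ)
    have hLμ := lambdaMax_sub_smul_nonneg hA hR (hlast hL hu) μ
    have hg : ε / δ - gFun eig A R μ ≤ ξ := by linarith [(abs_lt.1 hμ.abs_sub_lt).1]
    refine (quadRe_le_quadRe_sqrt_smul_add hA.1 hR hδ.le hμ0 hLμ hv hf).trans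
      (add_le_add_right ?_ _)
    calc μ * (ε - δ * gFun eig A R μ) = δ * μ * (ε / δ - gFun eig A R μ) := by field_simp
      _ ≤ δ * μ * ξ := by gcongr
      _ ≤ δ * K * ξ := by gcongr; exact hμle.trans (hμK μᵤ hμᵤ)

end Algorithm

section InnerProblem

variable {N I : ℕ} {JP : Matrix (Fin 5) (Fin 5) ℝ} {d : Fin 3 → Fin 5 → ℝ}
  {C R : Fin I → CMat N} {ε δ : Fin I → ℝ}

lemma innerObjective_le_add_iff {F f : Fin I → CVec N} {η : ℝ} :
    innerObjective JP d C F ≤ innerObjective JP d C f + η ↔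
      ∑ i, quadRe (C i) (f i) ≤ ∑ i, quadRe (C i) (F i) + η := by
  unfold innerObjective
  constructor <;> intro h <;> linarith

lemma innerObjective_le_iff {F f : Fin I → CVec N} :
    innerObjective JP d C F ≤ innerObjective JP d C f ↔
      ∑ i, quadRe (C i) (f i) ≤ ∑ i, quadRe (C i) (F i) := by
  simpa using innerObjective_le_add_iff (η := 0)

lemma isInnerSolution_iff {f : Fin I → CVec N} :
    IsInnerSolution JP d C R ε δ f ↔ ∀ i, IsSubcarrierSolution (C i) (R i) (ε i) (δ i) (f i) := by
  constructor
  · refine fun ⟨hf, hmin⟩ i => ⟨hf i, fun x hx => ?_⟩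
    have hmem : Function.update f i x ∈ innerFeasible R ε δ :=
      (Function.forall_update_iff f fun j y => y ∈ feasible (R j) (ε j) (δ j)).2
        ⟨hx, fun j _ => hf j⟩
    have hrest : ∑ j ∈ {i}ᶜ, quadRe (C j) (Function.update f i x j) =
        ∑ j ∈ {i}ᶜ, quadRe (C j) (f j) :=
      Finset.sum_congr rfl fun j hj => by rw [Function.update_of_ne (by simpa using hj)]
    have hsum := innerObjective_le_iff.1 (hmin hmem)
    rw [Fintype.sum_eq_add_sum_compl i, Fintype.sum_eq_add_sum_compl i fun j => quadRe (C j) (f j),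
      Function.update_self, hrest] at hsum
    exact le_of_add_le_add_right hsum
  · exact fun h => ⟨fun i => (h i).1, fun x hx =>
      innerObjective_le_iff.2 (Finset.sum_le_sum fun i _ => (h i).2 (hx i))⟩

lemma exists_tolerance_forall_innerObjective_le {A : Fin I → CMat N} {eig : CMat N → CVec N}
    {η : ℝ} (he : IsEigRoutine eig) (hA : ∀ i, A i = hermPart (C i))
    (hApos : ∀ i, (A i).PosSemidef) (hR : ∀ i, (R i).IsHermitian) (hε : ∀ i, 0 ≤ ε i)
    (hδ : ∀ i, 0 < δ i)
    (hlast : ∀ i, 0 < lambdaMax (A i) → ε i / δ i < quadRe (R i) (eig (A i)) → HasKernel (R i))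
    (hη : 0 < η) :
    ∃ ξ₀, 0 < ξ₀ ∧ ∀ ξ, 0 < ξ → ξ ≤ ξ₀ → ∀ F : Fin I → CVec N,
      (∀ i, AlgorithmReturns eig (A i) (R i) (ε i) (δ i) ξ (F i)) →
        ∀ f ∈ innerFeasible R ε δ, innerObjective JP d C F ≤ innerObjective JP d C f + η := by
  choose K hK hμK using fun i => exists_forall_doublingReturns_le (gFun eig (A i) (R i)) (ε i / δ i)
  set S := ∑ i, δ i * K i
  have hS : 0 ≤ S := Finset.sum_nonneg fun i _ => mul_nonneg (hδ i).le (hK i)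
  refine ⟨η / (S + 1), by positivity, fun ξ hξ hξ₀ F hF f hf => innerObjective_le_add_iff.2 ?_⟩
  have hloss : S * ξ ≤ η :=
    calc S * ξ ≤ (S + 1) * ξ := by gcongr; exact le_add_of_nonneg_right zero_le_one
      _ ≤ η := (le_div_iff₀' (by positivity)).1 hξ₀
  have hsub i : quadRe (C i) (f i) ≤ quadRe (C i) (F i) + δ i * K i * ξ := by
    rw [← quadRe_hermPart (C i), ← quadRe_hermPart (C i), ← hA]
    exact (hF i).quadRe_le_add he (hApos i) (hR i) (hε i) (hδ i) (hlast i) (hK i) (hμK i) hξ.le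
      (hf i)
  calc ∑ i, quadRe (C i) (f i) ≤ ∑ i, (quadRe (C i) (F i) + δ i * K i * ξ) :=
        Finset.sum_le_sum fun i _ => hsub i
    _ = ∑ i, quadRe (C i) (F i) + S * ξ := by rw [Finset.sum_add_distrib, Finset.sum_mul]
    _ ≤ ∑ i, quadRe (C i) (F i) + η := by gcongr

end InnerProblem

theorem proposition2_general {N I : ℕ} (d : Fin 3 → Fin 5 → ℝ) (JP : Matrix (Fin 5) (Fin 5) ℝ)
    (ε δ : Fin I → ℝ) (hε : ∀ i, 0 < ε i) (hδ : ∀ i, 0 < δ i) (C A R : Fin I → CMat N)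
    (hA : ∀ i, A i = hermPart (C i)) (hApos : ∀ i, (A i).PosSemidef)
    (hR : ∀ i, (R i).IsHermitian) :
    (∀ f : Fin I → CVec N, IsInnerSolution JP d C R ε δ f ↔
      ∀ i, IsSubcarrierSolution (A i) (R i) (ε i) (δ i) (f i)) ∧
    (∀ i, lambdaMax (A i) ≤ 0 → IsSubcarrierSolution (A i) (R i) (ε i) (δ i) 0) ∧
    (∀ i, ∀ u : CVec N, 0 < lambdaMax (A i) → IsPrincipalUnitEigenvector (A i) u →
      quadRe (R i) u ≤ ε i / δ i →
      IsSubcarrierSolution (A i) (R i) (ε i) (δ i) ((Real.sqrt (δ i) : ℂ) • u)) ∧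
    (∀ i, ∀ μ : ℝ, 0 < μ → (HasKernel (R i) ∨ 0 ≤ lambdaMax (A i - (μ : ℂ) • R i)) →
      ∀ v : CVec N, IsPrincipalUnitEigenvector (A i - (μ : ℂ) • R i) v →
      quadRe (R i) v = ε i / δ i →
      IsSubcarrierSolution (A i) (R i) (ε i) (δ i) ((Real.sqrt (δ i) : ℂ) • v)) ∧
    (∀ eig : CMat N → CVec N, IsEigRoutine eig → ∀ i, HasKernel (R i) →
      NonDegenerate (A i) (R i) → ε i / δ i < quadRe (R i) (eig (A i)) →
      ∃ μᵤ : ℝ, DoublingReturns (gFun eig (A i) (R i)) (ε i / δ i) μᵤ ∧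
        ∃ μ : ℝ, 0 < μ ∧
          Tendsto (bisectMid (gFun eig (A i) (R i)) (ε i / δ i) μᵤ) atTop (𝓝 μ) ∧
          gFun eig (A i) (R i) μ = ε i / δ i ∧
          IsSubcarrierSolution (A i) (R i) (ε i) (δ i)
            ((Real.sqrt (δ i) : ℂ) • eig (A i - (μ : ℂ) • R i))) ∧
    (∀ eig : CMat N → CVec N, IsEigRoutine eig →
      (∀ i, 0 < lambdaMax (A i) → ε i / δ i < quadRe (R i) (eig (A i)) →
        HasKernel (R i) ∧ NonDegenerate (A i) (R i)) →
      (∀ ξ : ℝ, 0 < ξ → ∀ i, ∃ f, AlgorithmReturns eig (A i) (R i) (ε i) (δ i) ξ f) ∧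
      (∀ ξ : ℝ, 0 < ξ → ∀ i f, AlgorithmReturns eig (A i) (R i) (ε i) (δ i) ξ f →
        quadRe (R i) f ≤ ε i + δ i * ξ ∧ ‖f‖ ^ 2 ≤ δ i) ∧
      (∀ η : ℝ, 0 < η → ∃ ξ₀ : ℝ, 0 < ξ₀ ∧ ∀ ξ : ℝ, 0 < ξ → ξ ≤ ξ₀ →
        ∀ F : Fin I → CVec N,
          (∀ i, AlgorithmReturns eig (A i) (R i) (ε i) (δ i) ξ (F i)) →
          ∀ f ∈ innerFeasible R ε δ,
            innerObjective JP d C F ≤ innerObjective JP d C f + η)) := by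
  have hH i := (hApos i).1
  refine ⟨fun f => ?_, fun i => isSubcarrierSolution_zero (hH i) (hε i).le (hδ i).le,
    fun i u hL hu => isSubcarrierSolution_sqrt_smul_principal (hH i) (hR i) (hδ i) hL.le hu,
    fun i μ hμ hKL v hv hq => ?_, fun eig he i hK hnd hu => ?_, fun eig he hlast => ⟨?_, ?_, ?_⟩⟩
  · simp only [isInnerSolution_iff, hA, isSubcarrierSolution_hermPart]
  · have hL := hKL.elim (fun hK => lambdaMax_sub_smul_nonneg (hApos i) (hR i) hK μ) id
    exact isSubcarrierSolution_sqrt_smul (hH i) (hR i) (hδ i) hμ.le hL hv hq.le (.inr hq)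
  · obtain ⟨μᵤ, hμᵤ, μ, hμ, hq, hlim, -⟩ := exists_doublingReturns_tendsto_bisectMid he (hApos i)
      (hR i) hK hnd (div_pos (hε i) (hδ i)) hu
    have hL := lambdaMax_sub_smul_nonneg (hApos i) (hR i) hK μ
    have hv := he _ (isHermitian_sub_smul (hH i) (hR i) μ)
    exact ⟨μᵤ, hμᵤ, μ, hμ, hlim, hq,
      isSubcarrierSolution_sqrt_smul (hH i) (hR i) (hδ i) hμ.le hL hv hq.le (.inr hq)⟩
  · exact fun ξ hξ i => exists_algorithmReturns he (hApos i) (hR i) (hε i) (hδ i) (hlast i) hξ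
  · exact fun ξ hξ i f hf => hf.mem_feasible he (hH i) (hR i) (hε i).le (hδ i) hξ.le
  · exact fun η hη => exists_tolerance_forall_innerObjective_le he hA hApos hR (fun i => (hε i).le)
      hδ (fun i hL hu => (hlast i hL hu).1) hη

theorem proposition2 {N I Npu : ℕ}
    -- the law of the unknown state, the noise level, the derivative vectors and the fixed `d_j`
    {Γ : Type*} [MeasurableSpace Γ] (P : Measure Γ) [IsProbabilityMeasure P]
    (σ : ℝ) (hσ : 0 < σ)
    (c : Fin I → Fin 5 → Γ → CVec N) (hc : ∀ i r, MemLp (c i r) 2 P)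
    (d : Fin 3 → Fin 5 → ℝ) (JP : Matrix (Fin 5) (Fin 5) ℝ)
    -- the transmit power, the channels to the primary users, the budgets
    (Psb : ℝ) (hPsb : 0 < Psb) (h : Fin I → Fin Npu → CVec N)
    (ε δ : Fin I → ℝ) (hε : ∀ i, 0 < ε i) (hδ : ∀ i, 0 < δ i)
    -- the matrices `C̄[i]`, `A[i]`, `R[i]`
    (C A R : Fin I → CMat N) (hC : ∀ i, C i = CBar P σ (c i) d)
    (hA : ∀ i, A i = hermPart (C i)) (hR : ∀ i, R i = RPu Psb (h i)) :
    -- the inner problem decouples over the subcarriers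
    (∀ f : Fin I → CVec N, IsInnerSolution JP d C R ε δ f ↔
      ∀ i, IsSubcarrierSolution (A i) (R i) (ε i) (δ i) (f i)) ∧
    -- first case
    (∀ i, lambdaMax (A i) ≤ 0 → IsSubcarrierSolution (A i) (R i) (ε i) (δ i) 0) ∧
    -- second case
    (∀ i, ∀ u : CVec N, 0 < lambdaMax (A i) → IsPrincipalUnitEigenvector (A i) u →
      quadRe (R i) u ≤ ε i / δ i →
      IsSubcarrierSolution (A i) (R i) (ε i) (δ i) ((Real.sqrt (δ i) : ℂ) • u)) ∧
    -- third case: optimality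
    (∀ i, ∀ μ : ℝ, 0 < μ → (HasKernel (R i) ∨ 0 ≤ lambdaMax (A i - (μ : ℂ) • R i)) →
      ∀ v : CVec N, IsPrincipalUnitEigenvector (A i - (μ : ℂ) • R i) v → quadRe (R i) v = ε i / δ i →
      IsSubcarrierSolution (A i) (R i) (ε i) (δ i) ((Real.sqrt (δ i) : ℂ) • v)) ∧
    -- third case: the multiplier exists and is the limit of the bisection
    (∀ eig : CMat N → CVec N, IsEigRoutine eig → ∀ i, HasKernel (R i) →
      NonDegenerate (A i) (R i) → 0 < lambdaMax (A i) →
      ε i / δ i < quadRe (R i) (eig (A i)) →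
      ∃ μᵤ : ℝ, DoublingReturns (gFun eig (A i) (R i)) (ε i / δ i) μᵤ ∧
        ∃ μ : ℝ, 0 < μ ∧
          Tendsto (bisectMid (gFun eig (A i) (R i)) (ε i / δ i) μᵤ) atTop (𝓝 μ) ∧
          gFun eig (A i) (R i) μ = ε i / δ i ∧
          IsSubcarrierSolution (A i) (R i) (ε i) (δ i)
            ((Real.sqrt (δ i) : ℂ) • eig (A i - (μ : ℂ) • R i))) ∧
    -- the algorithm with a positive tolerance, on all subcarriers
    (∀ eig : CMat N → CVec N, IsEigRoutine eig →
      (∀ i, 0 < lambdaMax (A i) → ε i / δ i < quadRe (R i) (eig (A i)) →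
        HasKernel (R i) ∧ NonDegenerate (A i) (R i)) →
      (∀ ξ : ℝ, 0 < ξ → ∀ i, ∃ f, AlgorithmReturns eig (A i) (R i) (ε i) (δ i) ξ f) ∧
      (∀ ξ : ℝ, 0 < ξ → ∀ i f, AlgorithmReturns eig (A i) (R i) (ε i) (δ i) ξ f →
        quadRe (R i) f ≤ ε i + δ i * ξ ∧ ‖f‖ ^ 2 ≤ δ i) ∧
      (∀ η : ℝ, 0 < η → ∃ ξ₀ : ℝ, 0 < ξ₀ ∧ ∀ ξ : ℝ, 0 < ξ → ξ ≤ ξ₀ →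
        ∀ F : Fin I → CVec N,
          (∀ i, AlgorithmReturns eig (A i) (R i) (ε i) (δ i) ξ (F i)) →
          ∀ f ∈ innerFeasible R ε δ,
            innerObjective JP d C F ≤ innerObjective JP d C f + η)) := by
  obtain ⟨h0, h1, h2, h3, h4, h5⟩ := proposition2_general d JP ε δ hε hδ C A R hA
    (fun i => hA i ▸ hC i ▸ posSemidef_hermPart_CBar σ (hc i) d)
    fun i => hR i ▸ isHermitian_RPu Psb (h i)
  exact ⟨h0, h1, h2, h3, fun eig he i hK hnd _ => h4 eig he i hK hnd, h5⟩
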